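/- Let $r\ge 2$ and let $V$ be a nonempty finite set (for instance $V=[n]$, $n\ge 1$). A weighted $r$-graph $G$ with vertex set $V$ is a function $G:V^{(r)}\to[0,\infty)$ on the family $V^{(r)}$ of all $r$-element subsets of $V$; its edge set is $E(G)=\{e\in V^{(r)}: G(e)>0\}$, and the degree of a vertex $v$ is $d_v=\sum_{e\in E(G),\,v\in e}G(e)$. The adjacency matrix $A(G)$ is the symmetric nonnegative $r$-matrix whose entry $a_{i_1,\ldots,i_r}$, for $(i_1,\ldots,i_r)\in V^r$, is $G(\{i_1,\ldots,i_r\})$ if $\{i_1,\ldots,i_r\}\in E(G)$, and $0$ otherwise. A complex number $\lambda$ is an eigenvalue of $A(G)$ if there is a nonzero vector $x\in\mathbb{C}^V$ such that \[ \lambda x_k^{r-1}=\sum_{i_2,\ldots,i_r\in V}a_{k,i_2,\ldots,i_r}\,x_{i_2}\cdots x_{i_r}\qquad\text{for all }k\in V . \] Then among the eigenvalues of $A(G)$ there is one of largest modulus; and this largest modulus, the spectral radius $\rho(G)$ of $G$, satisfies \[ \rho(G)^r\le \bigl((r-1)!\bigr)^r\max_{\{i_1,\ldots,i_r\}\in E(G)}d_{i_1}\cdots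 d_{i_r}, \] where the maximum is understood to be $0$ if $G$ has no edges. -/

import Mathlib

noncomputable section

/-- A cubical `r`-matrix with index set `V` and entries in `R`: a function of `r` indices. -/
abbrev CubicalMatrix (V R : Type*) (r : ℕ) : Type _ := (Fin r → V) → R

namespace CubicalMatrix

/-- `μ` is an eigenvalue of the cubical `r`-matrix `A` if there is a nonzero complex vector `x` with
`μ * x_k ^ (r - 1) = ∑_{i_2, …, i_r} a_{k, i_2, …, i_r} x_{i_2} ⋯ x_{i_r}` for every `k`.
The sum runs over the tuples `(i_1, …, i_r)` whose first index `i_1` is `k` (positions are numbered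
from `0` in `Fin r`), and the product over all positions other than the first. -/
def IsEigenvalue {V : Type*} [Fintype V] [DecidableEq V] {r : ℕ} [NeZero r]
    (A : CubicalMatrix V ℂ r) (μ : ℂ) : Prop :=
  ∃ x : V → ℂ, x ≠ 0 ∧ ∀ k : V,
    μ * x k ^ (r - 1) =
      ∑ i : Fin r → V with i 0 = k, A i * ∏ j ∈ Finset.univ.erase (0 : Fin r), x (i j)

/-- The set of the moduli of the eigenvalues of `A`. -/
def eigenvalueModuli {V : Type*} [Fintype V] [DecidableEq V] {r : ℕ} [NeZero r]
    (A : CubicalMatrix V ℂ r) : Set ℝ :=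
  {t | ∃ μ : ℂ, A.IsEigenvalue μ ∧ ‖μ‖ = t}

/-- The spectral radius of `A`: the largest modulus of an eigenvalue of `A`. -/
def spectralRadius {V : Type*} [Fintype V] [DecidableEq V] {r : ℕ} [NeZero r]
    (A : CubicalMatrix V ℂ r) : ℝ :=
  sSup A.eigenvalueModuli

end CubicalMatrix

/-- A weighted `r`-graph with vertex set `V`: a nonnegative real function on the family of the
`r`-element subsets of `V`. -/
structure WeightedRGraph (V : Type*) (r : ℕ) where
  weight : {e : Finset V // e.card = r} → ℝ
  weight_nonneg : ∀ e, 0 ≤ weight e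

namespace WeightedRGraph

variable {V : Type*} [Fintype V] [DecidableEq V] {r : ℕ}

/-- The edges are the `r`-subsets of positive weight. -/
def edges (G : WeightedRGraph V r) : Finset {e : Finset V // e.card = r} :=
  Finset.univ.filter (fun e => 0 < G.weight e)

/-- The degree of `v`: the sum of the weights of the edges containing `v`. -/
def degree (G : WeightedRGraph V r) (v : V) : ℝ :=
  ∑ e ∈ G.edges.filter (fun e => v ∈ e.val), G.weight e

/-- The adjacency matrix of `G`: the entry at `(i_1, …, i_r)` is the weight of `{i_1, …, i_r}`
if this set is an edge (so that the indices are distinct), and `0` otherwise; an `r`-subset that is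
not an edge has weight `0`. -/
def adjMatrix (G : WeightedRGraph V r) : CubicalMatrix V ℝ r := fun i =>
  if h : (Finset.univ.image i).card = r then G.weight ⟨Finset.univ.image i, h⟩ else 0

/-- The adjacency matrix with its entries viewed as complex numbers. -/
def adjMatrixComplex (G : WeightedRGraph V r) : CubicalMatrix V ℂ r := fun i =>
  (G.adjMatrix i : ℂ)

/-- The spectral radius of a weighted `r`-graph is that of its adjacency matrix. -/
def spectralRadius [NeZero r] (G : WeightedRGraph V r) : ℝ :=
  G.adjMatrixComplex.spectralRadius

/-- The maximum over the edges `{i_1, …, i_r}` of `d_{i_1} ⋯ d_{i_r}`; it is `0` by convention if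
`G` has no edges. -/
def maxEdgeDegreeProd (G : WeightedRGraph V r) : ℝ :=
  if h : G.edges.Nonempty then
    G.edges.sup' h (fun e => ∏ v ∈ e.val, G.degree v)
  else 0

end WeightedRGraph

end

open Finset

namespace CubicalMatrix

variable {V : Type*} [Fintype V] [DecidableEq V] {r : ℕ} [NeZero r]

/-! Take an eigenvector `x` for `μ` and let `M` be the maximum of `∏ ‖x v‖` over edges. Multiplying
the `k`-th equation by `x k` turns each term into an entry times a full edge product, so `‖μ‖ ‖x k‖
^ r ≤ (r - 1)! d_k M` (`norm_mul_pow_le`). Multiplying this over the vertices of a maximizing edge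
gives `M ^ r` on both sides, which cancels if `M > 0`; if `M = 0`, then `μ = 0`. A largest modulus
exists because the set of moduli is compact and nonempty. -/

/-- An eigenvector may be normalized. -/
theorem IsEigenvalue.exists_norm_eq_one {A : CubicalMatrix V ℂ r} {μ : ℂ}
    (h : A.IsEigenvalue μ) :
    ∃ x : V → ℂ, ‖x‖ = 1 ∧ ∀ k : V, μ * x k ^ (r - 1) =
      ∑ i : Fin r → V with i 0 = k, A i * ∏ j ∈ Finset.univ.erase (0 : Fin r), x (i j) := by
  obtain ⟨x, hx, hk⟩ := h
  refine ⟨((‖x‖⁻¹ : ℝ) : ℂ) • x, ?_, fun k => ?_⟩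
  · rw [norm_smul, Complex.norm_real, norm_inv, norm_norm, inv_mul_cancel₀ (norm_ne_zero_iff.2 hx)]
  · simp only [Pi.smul_apply, smul_eq_mul, mul_pow, prod_mul_distrib, prod_const,
      card_erase_of_mem (mem_univ (0 : Fin r)), card_univ, Fintype.card_fin]
    rw [mul_left_comm, hk k, mul_sum]
    exact sum_congr rfl fun i _ => mul_left_comm _ _ _

/-- The eigenvalues are bounded by the sum of the moduli of the entries. -/
theorem IsEigenvalue.norm_le {A : CubicalMatrix V ℂ r} {μ : ℂ} (h : A.IsEigenvalue μ) :
    ‖μ‖ ≤ ∑ i, ‖A i‖ := by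
  obtain ⟨x, hx, hk⟩ := h
  obtain ⟨v, hv⟩ := Function.ne_iff.1 hx
  have : Nonempty V := ⟨v⟩
  obtain ⟨m, hm⟩ := Finite.exists_max fun k => ‖x k‖
  have hpos : 0 < ‖x m‖ := (norm_pos_iff.2 hv).trans_le (hm v)
  refine le_of_mul_le_mul_right ?_ (pow_pos hpos (r - 1))
  calc ‖μ‖ * ‖x m‖ ^ (r - 1) = ‖μ * x m ^ (r - 1)‖ := by rw [norm_mul, norm_pow]
    _ ≤ ∑ i : Fin r → V with i 0 = m, ‖A i‖ * ‖x m‖ ^ (r - 1) := by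
      rw [hk m]
      refine norm_sum_le_of_le _ fun i _ => ?_
      rw [norm_mul, norm_prod]
      refine mul_le_mul_of_nonneg_left ?_ (norm_nonneg _)
      refine (prod_le_prod (fun _ _ => norm_nonneg _) fun j _ => hm (i j)).trans_eq ?_
      simp [card_erase_of_mem]
    _ ≤ (∑ i, ‖A i‖) * ‖x m‖ ^ (r - 1) := by
      rw [sum_mul]
      exact sum_le_sum_of_subset_of_nonneg (filter_subset _ _) fun _ _ _ => by positivity

/-- Normalized eigenpairs form a closed subset of a ball times the unit sphere, and the moduli are
its continuous image. -/
theorem isCompact_eigenvalueModuli (A : CubicalMatrix V ℂ r) :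
    IsCompact A.eigenvalueModuli := by
  have hc : IsClosed {p : ℂ × (V → ℂ) | ∀ k : V, p.1 * p.2 k ^ (r - 1) =
      ∑ i : Fin r → V with i 0 = k,
        A i * ∏ j ∈ Finset.univ.erase (0 : Fin r), p.2 (i j)} := by
    rw [Set.ofPred_forall]
    exact isClosed_iInter fun k => isClosed_eq (by fun_prop) (by fun_prop)
  have hK := (((isCompact_closedBall (0 : ℂ) (∑ i, ‖A i‖)).prod
    (isCompact_sphere (0 : V → ℂ) 1)).inter_right hc).image
      (continuous_norm.comp continuous_fst)
  convert hK using 1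
  ext t
  constructor
  · rintro ⟨μ, hμ, rfl⟩
    obtain ⟨x, hx, hk⟩ := hμ.exists_norm_eq_one
    exact ⟨(μ, x), ⟨⟨mem_closedBall_zero_iff.2 hμ.norm_le, mem_sphere_zero_iff_norm.2 hx⟩, hk⟩, rfl⟩
  · rintro ⟨⟨μ, x⟩, ⟨⟨-, hx⟩, hk⟩, rfl⟩
    refine ⟨μ, ⟨x, ?_, hk⟩, rfl⟩
    rintro rfl
    simp at hx

/-- A square matrix has an eigenvalue. -/
theorem exists_isEigenvalue_of_two [Nonempty V] (hr : r = 2) (A : CubicalMatrix V ℂ r) :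
    ∃ μ, A.IsEigenvalue μ := by
  subst hr
  let f : Module.End ℂ (V → ℂ) :=
    { toFun := fun x k => ∑ i : Fin 2 → V with i 0 = k, A i * x (i 1)
      map_add' := fun x y => by ext k; simp [mul_add, sum_add_distrib]
      map_smul' := fun c x => by ext k; simp [mul_sum, mul_left_comm] }
  obtain ⟨μ, hμ⟩ := Module.End.exists_eigenvalue f
  obtain ⟨x, hx⟩ := hμ.exists_hasEigenvector
  refine ⟨μ, x, hx.2, fun k => ?_⟩
  have he : Finset.univ.erase (0 : Fin 2) = {1} := by ext j; fin_cases j <;> simp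
  have := congrFun hx.apply_eq_smul k
  simpa [he, f] using this.symm

end CubicalMatrix

namespace WeightedRGraph

open CubicalMatrix

variable {V : Type*} [DecidableEq V] {r : ℕ}

theorem adjMatrix_nonneg (G : WeightedRGraph V r) (i : Fin r → V) : 0 ≤ G.adjMatrix i := by
  unfold adjMatrix
  split_ifs
  exacts [G.weight_nonneg _, le_rfl]

variable [Fintype V]

theorem degree_nonneg (G : WeightedRGraph V r) (v : V) : 0 ≤ G.degree v :=
  sum_nonneg fun e _ => G.weight_nonneg e

/-- A nonzero entry of the adjacency matrix is the weight of an edge, listed injectively. -/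
theorem exists_edge_of_adjMatrix_ne_zero (G : WeightedRGraph V r) {i : Fin r → V}
    (h : G.adjMatrix i ≠ 0) :
    ∃ e ∈ G.edges, univ.image i = e.val ∧ Function.Injective i ∧ G.adjMatrix i = G.weight e := by
  unfold adjMatrix at h ⊢
  split_ifs at h ⊢ with hc
  · refine ⟨⟨_, hc⟩, ?_, rfl, ?_, rfl⟩
    · exact mem_filter.2 ⟨mem_univ _, (G.weight_nonneg _).lt_of_ne' h⟩
    · exact Set.injOn_univ.1 (coe_univ (α := Fin r) ▸
      card_image_iff.1 (by rw [hc, card_univ, Fintype.card_fin]))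
  · exact absurd rfl h

/-- For `r = 2` this is linear algebra. For `r ≥ 3` the indicator of a single vertex has eigenvalue
`0`, since every term involves at least two distinct vertices besides the first. -/
theorem exists_isEigenvalue [Nonempty V] [NeZero r] (hr : 2 ≤ r) (G : WeightedRGraph V r) :
    ∃ μ, G.adjMatrixComplex.IsEigenvalue μ := by
  rcases hr.eq_or_lt with h2 | h3
  · exact exists_isEigenvalue_of_two h2.symm _
  obtain ⟨v⟩ := ‹Nonempty V›
  refine ⟨0, Pi.single v 1, fun h => by simpa using congrFun h v, fun k => ?_⟩
  rw [zero_mul, eq_comm]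
  refine sum_eq_zero fun i _ => ?_
  by_contra hne
  obtain ⟨hA, hp⟩ := mul_ne_zero_iff.1 hne
  obtain ⟨-, -, -, hi, -⟩ := G.exists_edge_of_adjMatrix_ne_zero (i := i)
    fun h => hA (by simp [adjMatrixComplex, h])
  have hv : ∀ j : Fin r, j ≠ 0 → i j = v := fun j hj => by
    have := prod_ne_zero_iff.1 hp j (mem_erase.2 ⟨hj, mem_univ _⟩)
    by_contra hjv
    exact this (Pi.single_eq_of_ne hjv 1)
  have hz : ∀ j : Fin r, j.val ≠ 0 → j ≠ 0 := fun j hj h => hj (by simp [h])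
  -- Positions `1` and `2` both carry `v`, against injectivity; this is where `r ≥ 3` enters.
  have := hi ((hv ⟨1, by omega⟩ (hz _ (by simp))).trans (hv ⟨2, h3⟩ (hz _ (by simp))).symm)
  simp at this

/-- There are at most `(r - 1)!` listings of an `r`-set with prescribed first element. -/
theorem card_listings_le [NeZero r] (e : {e : Finset V // e.card = r}) (k : V) (hk : k ∈ e.val) :
    #{i : Fin r → V | i 0 = k ∧ univ.image i = e.val} ≤ (r - 1).factorial := by
  have hcard : Fintype.card ({j : Fin r // j ≠ 0} ↪ {v // v ∈ e.val.erase k}) =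
      (r - 1).factorial := by
    rw [Fintype.card_embedding_eq, Fintype.card_coe, card_erase_of_mem hk, e.2]
    simp [Nat.descFactorial_self]
  rw [← hcard, ← Fintype.card_coe]
  have hinj : ∀ i : {i : Fin r → V // i ∈ ({i | i 0 = k ∧ univ.image i = e.val} : Finset _)},
      Function.Injective i.1 := fun i => by
    have := (mem_filter.1 i.2).2.2
    exact Set.injOn_univ.1 (coe_univ (α := Fin r) ▸
      card_image_iff.1 (by rw [this, e.2, card_univ, Fintype.card_fin]))
  -- Dropping the fixed first entry embeds the other `r - 1` positions into `e \ {k}`.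
  refine Fintype.card_le_of_injective (fun i => ⟨fun j => ⟨i.1 j.1, ?_⟩, ?_⟩) ?_
  · have h := (mem_filter.1 i.2).2
    refine mem_erase.2 ⟨fun hj => j.2 (hinj i (hj.trans h.1.symm)), ?_⟩
    exact h.2.subset (mem_image_of_mem i.1 (mem_univ j.1))
  · intro a b hab
    exact Subtype.ext (hinj i (congrArg Subtype.val hab))
  · intro a b hab
    refine Subtype.ext (funext fun j => ?_)
    by_cases hj : j = 0
    · subst hj
      exact (mem_filter.1 a.2).2.1.trans (mem_filter.1 b.2).2.1.symm
    · exact congrArg Subtype.val (DFunLike.congr_fun hab (⟨j, hj⟩ : {j : Fin r // j ≠ 0}))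

/-- Double counting: each edge at `k` contributes its weight once per listing that starts with `k`.
-/
theorem sum_adjMatrix_le [NeZero r] (G : WeightedRGraph V r) (k : V) :
    ∑ i : Fin r → V with i 0 = k, G.adjMatrix i ≤ (r - 1).factorial * G.degree k := by
  have hle : ∀ i ∈ ({i | i 0 = k} : Finset (Fin r → V)), G.adjMatrix i ≤
      ∑ e ∈ G.edges with k ∈ e.val, if univ.image i = e.val then G.weight e else 0 := by
    intro i hi
    have hnn : ∀ e ∈ ({e ∈ G.edges | k ∈ e.val} : Finset _),
        0 ≤ if univ.image i = e.val then G.weight e else 0 := fun e _ => by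
      split_ifs
      exacts [G.weight_nonneg e, le_rfl]
    by_cases h : G.adjMatrix i = 0
    · rw [h]
      exact sum_nonneg hnn
    · obtain ⟨e, he, him, -, hw⟩ := G.exists_edge_of_adjMatrix_ne_zero h
      have hke : k ∈ e.val := by
        rw [← him, ← (mem_filter.1 hi).2]
        exact mem_image_of_mem _ (mem_univ _)
      have := single_le_sum hnn (mem_filter.2 ⟨he, hke⟩)
      rwa [if_pos him, ← hw] at this
  refine (sum_le_sum hle).trans ?_
  rw [sum_comm, degree, mul_sum]
  refine sum_le_sum fun e he => ?_
  rw [← sum_filter, sum_const, filter_filter, nsmul_eq_mul]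
  exact mul_le_mul_of_nonneg_right
    (Nat.cast_le.2 (card_listings_le e k (mem_filter.1 he).2)) (G.weight_nonneg e)

/-- If `M` bounds the products of `‖x v‖` over the edges, then
`‖μ‖ ‖x k‖ ^ r ≤ (r - 1)! d_k M` for an eigenvector `x` with eigenvalue `μ`. -/
theorem norm_mul_pow_le [NeZero r] (G : WeightedRGraph V r) {μ : ℂ} {x : V → ℂ} {k : V}
    (hx : μ * x k ^ (r - 1) = ∑ i : Fin r → V with i 0 = k,
      G.adjMatrixComplex i * ∏ j ∈ Finset.univ.erase (0 : Fin r), x (i j))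
    {M : ℝ} (hM0 : 0 ≤ M) (hM : ∀ e ∈ G.edges, ∏ v ∈ e.val, ‖x v‖ ≤ M) :
    ‖μ‖ * ‖x k‖ ^ r ≤ (r - 1).factorial * G.degree k * M := by
  calc ‖μ‖ * ‖x k‖ ^ r = ‖μ * x k ^ (r - 1) * x k‖ := by
        rw [norm_mul, norm_mul, norm_pow, mul_assoc, pow_sub_one_mul (NeZero.ne r)]
    _ ≤ ∑ i : Fin r → V with i 0 = k, G.adjMatrix i * M := by
      rw [hx, sum_mul]
      refine norm_sum_le_of_le _ fun i hi => ?_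
      have hi0 : i 0 = k := (mem_filter.1 hi).2
      -- The extra factor `x k` fills the missing position `0`, so the product runs over all of `i`.
      rw [← hi0, mul_assoc, prod_erase_mul _ (fun j => x (i j)) (mem_univ (0 : Fin r)), norm_mul,
        norm_prod, adjMatrixComplex, Complex.norm_real, Real.norm_of_nonneg (G.adjMatrix_nonneg i)]
      by_cases h : G.adjMatrix i = 0
      · simp [h]
      · obtain ⟨e, he, him, hinj, -⟩ := G.exists_edge_of_adjMatrix_ne_zero h
        refine mul_le_mul_of_nonneg_left ?_ (G.adjMatrix_nonneg i)
        have := hM e he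
        rwa [← him, prod_image hinj.injOn] at this
    _ ≤ (r - 1).factorial * G.degree k * M := by
      rw [← sum_mul]
      exact mul_le_mul_of_nonneg_right (G.sum_adjMatrix_le k) hM0

theorem prod_degree_le_maxEdgeDegreeProd (G : WeightedRGraph V r)
    {e : {e : Finset V // e.card = r}} (he : e ∈ G.edges) :
    ∏ v ∈ e.val, G.degree v ≤ G.maxEdgeDegreeProd := by
  rw [maxEdgeDegreeProd, dif_pos ⟨e, he⟩]
  exact le_sup' (fun e : {e : Finset V // e.card = r} => ∏ v ∈ e.val, G.degree v) he

theorem maxEdgeDegreeProd_nonneg (G : WeightedRGraph V r) : 0 ≤ G.maxEdgeDegreeProd := by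
  by_cases h : G.edges.Nonempty
  · obtain ⟨e, he⟩ := h
    exact (prod_nonneg fun v _ => G.degree_nonneg v).trans (G.prod_degree_le_maxEdgeDegreeProd he)
  · rw [maxEdgeDegreeProd, dif_neg h]

theorem norm_pow_le_of_isEigenvalue [NeZero r] (G : WeightedRGraph V r) {μ : ℂ}
    (h : G.adjMatrixComplex.IsEigenvalue μ) :
    ‖μ‖ ^ r ≤ ((r - 1).factorial : ℝ) ^ r * G.maxEdgeDegreeProd := by
  obtain ⟨x, hx, hk⟩ := h
  by_cases hpos : ∃ e ∈ G.edges, 0 < ∏ v ∈ e.val, ‖x v‖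
  · obtain ⟨e₀, he₀, hpos⟩ := hpos
    obtain ⟨e, he, hmax⟩ := G.edges.exists_max_image
      (fun e : {e : Finset V // e.card = r} => ∏ v ∈ e.val, ‖x v‖) ⟨e₀, he₀⟩
    have hM : 0 < ∏ v ∈ e.val, ‖x v‖ := hpos.trans_le (hmax e₀ he₀)
    -- The `r` vertices of `e` yield `M ^ r` on the left from `∏ ‖x v‖ ^ r`, and on the right from
    -- the `r` factors `M`.
    have hprod := prod_le_prod (s := e.val) (fun v _ => by positivity)
      fun v _ => G.norm_mul_pow_le (hk v) hM.le hmax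
    simp only [prod_mul_distrib, prod_const, e.2, prod_pow] at hprod
    exact (le_of_mul_le_mul_right hprod (pow_pos hM r)).trans
      (mul_le_mul_of_nonneg_left (G.prod_degree_le_maxEdgeDegreeProd he) (by positivity))
  · push Not at hpos
    obtain ⟨v, hv⟩ := Function.ne_iff.1 hx
    -- Here `M = 0` is admissible, and a vertex with `x v ≠ 0` forces `μ = 0`.
    have hle := G.norm_mul_pow_le (hk v) le_rfl hpos
    rw [mul_zero] at hle
    have hμ : ‖μ‖ = 0 := le_antisymm
      (nonpos_of_mul_nonpos_left hle (pow_pos (norm_pos_iff.2 hv) r)) (norm_nonneg _)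
    rw [hμ, zero_pow (NeZero.ne r)]
    exact mul_nonneg (by positivity) G.maxEdgeDegreeProd_nonneg

end WeightedRGraph

theorem mainTheorem12 {V : Type*} [Fintype V] [DecidableEq V] [Nonempty V]
    (r : ℕ) [r.AtLeastTwo] (G : WeightedRGraph V r) :
    IsGreatest G.adjMatrixComplex.eigenvalueModuli G.spectralRadius ∧
    G.spectralRadius ^ r ≤ ((r - 1).factorial : ℝ) ^ r * G.maxEdgeDegreeProd := by
  obtain ⟨μ, hμ⟩ := G.exists_isEigenvalue Nat.AtLeastTwo.prop
  have hG : IsGreatest G.adjMatrixComplex.eigenvalueModuli G.spectralRadius :=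
    (CubicalMatrix.isCompact_eigenvalueModuli _).isGreatest_sSup ⟨_, μ, hμ, rfl⟩
  refine ⟨hG, ?_⟩
  obtain ⟨ν, hν, hνr⟩ := hG.1
  rw [← hνr]
  exact G.norm_pow_le_of_isEigenvalue hν
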